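/- **Model.** A walker moves on a line whose base is the point $0$; one unit of length is the distance he walks in one day (20 miles), and positions are distances from the base. Rations are packed in sealed boxes, each sufficient for one unit of walking; at the base there is an unlimited supply of them. At any moment the walker has at most one unsealed box, from which he eats while walking, and together with the sealed boxes he carries he never carries more than two rations. He may walk (as far as the contents of the unsealed box allow), pick up a sealed box at the base or where one has been dumped, dump a sealed box that he carries, and unseal a box that he carries, in which case the remainder of the previously unsealed box is thrown away. Unsealed boxes cannot be dumped for later use. For real $\gamma$, a *part-A walk for $\gamma$* is a finite sequence of such actions which starts at the base with nothing carried and nothing dumped, ends at the base, and leaves a sealed box at $\gamma$ and, if $\gamma>1$, another sealed box at $\gamma-1$. Its *duration* $t$ is the total distance walked, that is, its length in days. **Theorem.** Let $\gamma$ be a real number. Every part-A walk for $\gamma$ has a duration $t$ with $$t \ge 12\tfrac47\,\gamma-9\tfrac17 \qquad\text{and}\qquad t\ge 14\gamma-11 .$$ Moreover, the following three walks are part-A walks of minimal duration among all part-A walks for the same $\gamma$. (In each trip described below, the walker unseals a new box where the trip starts. If the trip dumps a box before picking one up, he also takes along a sealed box from the start of the trip, except that in a trip marked * he arrives carrying a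 box from the preceding trip, unseals that one, and takes along the other box lying there. "Dump at $x$" means walking to $x$ and dumping the box carried; "pick up at $x$" means walking to $x$ and picking up a box there.) 1. For $\gamma=\frac32$, part A of Dudeney's solution, of duration $10$: five times, dump at $\frac12$ and return to $0$; then dump at $\frac34$, return to $\frac12$; dump at $1$, return to $\frac12$; dump at $1$, pick up at $\frac34$, dump at $1$; dump at $\frac32$, return to $1$; return to $0$. 2. For $\gamma=\frac{23}{16}$, part A of the $22\frac9{16}$ days solution, of duration $9\frac18$: dump at $\frac1{16}$, return to $0$; dump at $\frac18$, pick up at $\frac1{16}$, dump at $\frac7{16}$, return to $0$; dump at $\frac5{16}$, pick up at $\frac18$, dump at $\frac5{16}$, return to $0$; twice, dump at $\frac12$ and return to $0$; dump at $\frac{21}{32}$, return to $\frac5{16}$; dump at $\frac78$, pick up at $\frac{21}{32}$, dump at $\frac{11}{16}$, return to $\frac12$; dump at $1$, pick up at $\frac{11}{16}$, walk with it to $\frac78$; * dump at $\frac{23}{16}$, return to $1$; return to $0$. 3. For $\gamma=\frac{141}{116}$, part A of the $23\frac{25}{116}$ days solution, of duration $6\frac4{29}$: twice, dump at $\frac1{29}$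 and return to $0$; dump at $\frac9{58}$, pick up at $\frac1{29}$, dump at $\frac6{29}$, pick up at $\frac1{29}$, dump at $\frac6{29}$, return to $0$; dump at $\frac12$, return to $0$; dump at $\frac{16}{29}$, pick up at $\frac12$, dump at $\frac{16}{29}$, return to $\frac6{29}$; dump at $\frac{51}{58}$, return to $\frac{16}{29}$; dump at $\frac{141}{116}$, return to $\frac{51}{58}$; pick up at $\frac9{58}$, dump at $\frac{25}{116}$, return to $0$. -/

import Mathlib

/-! The walk is modelled on a line, with the base at position `0`, one unit of length being the
distance that is walked in one day.  Each box contains the ration for one day, that is, for one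
unit of walking, and there is an unlimited supply of sealed boxes at the base. -/

noncomputable section

namespace Walkingholme

/-- The situation of the walker at some moment: his position, the part (between `0` and `1`) that
is left in the unsealed box he is eating from, the number of sealed boxes that he carries, and the
positions (with multiplicity) of the sealed boxes that have been dumped and not taken again. -/
structure State where
  pos : ℝ
  ration : ℝ
  carried : ℕ
  depots : Multiset ℝ

/-- The elementary actions: walking straight to a position, picking up a sealed box, dumping a
sealed box, and unsealing a box that is carried. -/
inductive Move where
  | walkTo (y : ℝ)
  | take
  | dump
  | openBox

/-- When an action is possible.  Walking consumes the contents of the unsealed box, a box can be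
taken only at the base or where one has been dumped, and never more than two rations are carried
(the contents of the unsealed box included). -/
def Move.Allowed (s : State) : Move → Prop
  | .walkTo y => |y - s.pos| ≤ s.ration
  | .take => (s.pos = 0 ∨ s.pos ∈ s.depots) ∧ (s.carried : ℝ) + 1 + s.ration ≤ 2
  | .dump => 1 ≤ s.carried
  | .openBox => 1 ≤ s.carried

/-- The situation after an action.  When a box is unsealed, the remainder of the previously
unsealed box is thrown away; only sealed boxes can be dumped. -/
def Move.result (s : State) : Move → State
  | .walkTo y => { s with pos := y, ration := s.ration - |y - s.pos| }
  | .take =>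
      { s with
        carried := s.carried + 1
        depots := if s.pos = 0 then s.depots else s.depots.erase s.pos }
  | .dump => { s with carried := s.carried - 1, depots := s.pos ::ₘ s.depots }
  | .openBox => { s with carried := s.carried - 1, ration := 1 }

/-- The time, in days, that an action takes. -/
def Move.time (s : State) : Move → ℝ
  | .walkTo y => |y - s.pos|
  | _ => 0

/-- All actions of the list are possible when they are performed in order, starting from `s`. -/
def Feasible : State → List Move → Prop
  | _, [] => True
  | s, a :: w => a.Allowed s ∧ Feasible (a.result s) w

/-- The situation after the actions of the list have been performed in order from `s`. -/
def finalState : State → List Move → State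
  | s, [] => s
  | s, a :: w => finalState (a.result s) w

/-- The total time taken by the actions of the list, performed in order from `s`. -/
def timeFrom : State → List Move → ℝ
  | _, [] => 0
  | s, a :: w => a.time s + timeFrom (a.result s) w

/-- At the beginning the walker is at the base, carries nothing, and nothing has been dumped. -/
def start : State := ⟨0, 0, 0, 0⟩

/-- The time in days that the walk takes. -/
def duration (w : List Move) : ℝ := timeFrom start w

/-- `w` is a part-A walk for `γ`: it starts and ends at the base, and leaves a sealed box at `γ`
and, in case `γ > 1`, another one at `γ - 1`.  (For `γ > 2` further boxes would be needed in
order to walk from `γ` to the base; they are not demanded here.) -/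
def IsPartA (γ : ℝ) (w : List Move) : Prop :=
  Feasible start w ∧ (finalState start w).pos = 0 ∧ γ ∈ (finalState start w).depots ∧
    (1 < γ → γ - 1 ∈ (finalState start w).depots)

/-- `w` is a part-A walk for `γ`, and no part-A walk for `γ` takes less time. -/
def IsOptimalPartA (γ : ℝ) (w : List Move) : Prop :=
  IsPartA γ w ∧ ∀ w' : List Move, IsPartA γ w' → duration w ≤ duration w'

open Move

/-- Unseal a new box at the current position and pick up another one. -/
def load : List Move := [take, openBox, take]

/-- From the base, dump one box at `x` and return to the base. -/
def deliver (x : ℝ) : List Move := load ++ [walkTo x, dump, walkTo 0]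

/-- Part A of Dudeney's solution: the boxes for later use are left at the 70 and 90 miles points,
that is, at distances `3 / 2` and `1 / 2` from the base. -/
def dudeneyPartA : List Move :=
  deliver (1 / 2) ++ deliver (1 / 2) ++ deliver (1 / 2) ++ deliver (1 / 2) ++ deliver (1 / 2)
  ++ load ++ [walkTo (3 / 4), dump, walkTo (1 / 2)]
  ++ load ++ [walkTo 1, dump, walkTo (1 / 2)]
  ++ load ++ [walkTo 1, dump, walkTo (3 / 4), take, walkTo 1, dump]
  ++ load ++ [walkTo (3 / 2), dump, walkTo 1]
  ++ [take, openBox, walkTo 0]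

/-- Part A of the circuit of `22 + 9 / 16` days: boxes are left at the `71 + 1 / 4` and
`91 + 1 / 4` miles points, that is, at distances `23 / 16` and `7 / 16` from the base. -/
def bestPartA : List Move :=
  deliver (1 / 16)
  ++ load ++ [walkTo (1 / 8), dump, walkTo (1 / 16), take, walkTo (7 / 16), dump, walkTo 0]
  ++ load ++ [walkTo (5 / 16), dump, walkTo (1 / 8), take, walkTo (5 / 16), dump, walkTo 0]
  ++ deliver (1 / 2) ++ deliver (1 / 2)
  ++ load ++ [walkTo (21 / 32), dump, walkTo (5 / 16)]
  ++ load ++ [walkTo (7 / 8), dump, walkTo (21 / 32), take, walkTo (11 / 16), dump,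
    walkTo (1 / 2)]
  ++ load ++ [walkTo 1, dump, walkTo (11 / 16), take, walkTo (7 / 8)]
  ++ [openBox, take, walkTo (23 / 16), dump, walkTo 1]
  ++ [take, openBox, walkTo 0]

/-- Part A of the circuit of `23 + 25 / 116` days that starts at dawn: boxes are left at the
`75 + 20 / 29` and `95 + 20 / 29` miles points, that is, at distances `141 / 116` and `25 / 116`
from the base. -/
def dawnPartA : List Move :=
  deliver (1 / 29) ++ deliver (1 / 29)
  ++ load ++ [walkTo (9 / 58), dump, walkTo (1 / 29), take, walkTo (6 / 29), dump,
    walkTo (1 / 29), take, walkTo (6 / 29), dump, walkTo 0]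
  ++ deliver (1 / 2)
  ++ load ++ [walkTo (16 / 29), dump, walkTo (1 / 2), take, walkTo (16 / 29), dump,
    walkTo (6 / 29)]
  ++ load ++ [walkTo (51 / 58), dump, walkTo (16 / 29)]
  ++ load ++ [walkTo (141 / 116), dump, walkTo (51 / 58)]
  ++ [take, openBox, walkTo (9 / 58), take, walkTo (25 / 116), dump, walkTo 0]

end Walkingholme

end

/-! Cut a walk into trips at the moments when a box is unsealed. For a level h ≥ 0, twice `boxExcess
h` minus the walker's own excess over h grows by at most the distance walked beyond h
(`Leg.transport`), because a walking man carries at most one sealed box. Let S be the sum of the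
positive parts of the unsealing positions and M the sum of their gains. Level 0 gives t ≥ 2(S + the
positive positions of the boxes left). Level 1/2, with at most one ration per trip, gives M ≥ γ -
1/2. A trip that puts a box at γ must begin and end near γ, where unsealing gains little; this gives
S - M ≥ 4γ - 4. Hence S ≥ 5γ - 9/2 and t ≥ 14γ - 11. The other bound comes from S ≥ (30γ - 25)/7,
proved in `TripStart.tripEnd` by asking how far that trip ends beyond all earlier positions. The
first two walks attain the former bound, the third the latter. -/

namespace Walkingholme

open Move

/-! ### Transport of boxes beyond a level within one trip. -/

/-- The total excess over `h` of the positions of the sealed boxes, carried or dumped. -/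
noncomputable def boxExcess (h : ℝ) (s : State) : ℝ :=
  s.carried * max (s.pos - h) 0 + (s.depots.map fun y => max (y - h) 0).sum

lemma sum_excess_nonneg (h : ℝ) (d : Multiset ℝ) :
    0 ≤ (d.map fun y => max (y - h) 0).sum :=
  Multiset.sum_nonneg fun x hx => by
    obtain ⟨y, -, rfl⟩ := Multiset.mem_map.1 hx
    exact le_max_right _ _

lemma excess_add_erase {y : ℝ} {d : Multiset ℝ} (hy : y ∈ d) (h : ℝ) :
    max (y - h) 0 + ((d.erase y).map fun z => max (z - h) 0).sum =
      (d.map fun z => max (z - h) 0).sum := by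
  conv_rhs => rw [← Multiset.cons_erase hy]
  simp

lemma excess_le_sum {y : ℝ} {d : Multiset ℝ} (hy : y ∈ d) (h : ℝ) :
    max (y - h) 0 ≤ (d.map fun z => max (z - h) 0).sum := by
  have := excess_add_erase hy h
  have := sum_excess_nonneg h (d.erase y)
  linarith

lemma sum_excess_eq_zero {h : ℝ} {d : Multiset ℝ} (hd : ∀ y ∈ d, y ≤ h) :
    (d.map fun y => max (y - h) 0).sum = 0 :=
  Multiset.sum_eq_zero fun x hx => by
    obtain ⟨y, hy, rfl⟩ := Multiset.mem_map.1 hx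
    exact max_eq_right (by linarith [hd y hy])

/-- The walker never carries more than two rations, and does not eat more than he has. -/
structure State.Valid (s : State) : Prop where
  ration_nonneg : 0 ≤ s.ration
  load_le : (s.carried : ℝ) + s.ration ≤ 2

/-- What can be said about a part of a walk from `A` to `B`, of length `d`, in which no box is
unsealed. -/
structure Leg (A B : State) (d : ℝ) : Prop where
  valid : B.Valid
  ration_eq : B.ration = A.ration - d
  dist_le : |B.pos - A.pos| ≤ d
  mem_depots : ∀ y ∈ B.depots, y ∈ A.depots ∨ |y - A.pos| + |y - B.pos| ≤ d
  -- Either nothing is gained beyond h, or h was reached, and then the ways from A up to h and from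
  -- h down to B come out of d too.
  transport : ∀ h : ℝ, 0 ≤ h →
    2 * (boxExcess h B - boxExcess h A) - (max (B.pos - h) 0 - max (A.pos - h) 0) ≤ 0 ∨
    2 * (boxExcess h B - boxExcess h A) - (max (B.pos - h) 0 - max (A.pos - h) 0)
      + max (h - A.pos) 0 + max (h - B.pos) 0 ≤ d

lemma Leg.refl {A : State} (hA : A.Valid) : Leg A A 0 where
  valid := hA
  ration_eq := by simp
  dist_le := by simp
  mem_depots y hy := Or.inl hy
  transport h _ := by left; simp

lemma max_sub_le_add_abs (h x y : ℝ) : max (h - x) 0 ≤ max (h - y) 0 + |y - x| :=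
  max_le (by linarith [le_max_left (h - y) 0, le_abs_self (y - x)]) (by positivity)

lemma Leg.trans {A B C : State} {d e : ℝ} (h₁ : Leg A B d) (h₂ : Leg B C e) :
    Leg A C (d + e) where
  valid := h₂.valid
  ration_eq := by rw [h₂.ration_eq, h₁.ration_eq]; ring
  dist_le := by
    have := abs_sub_le C.pos B.pos A.pos
    linarith [h₁.dist_le, h₂.dist_le]
  mem_depots y hy := by
    have hd := h₁.dist_le
    have he := h₂.dist_le
    rcases h₂.mem_depots y hy with h | h
    · rcases h₁.mem_depots y h with h' | h'
      · exact Or.inl h'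
      · right
        have := abs_sub_le y B.pos C.pos
        rw [abs_sub_comm B.pos] at this
        linarith
    · right
      have := abs_sub_le y B.pos A.pos
      linarith
  transport h hh := by
    have hd := h₁.dist_le
    have he := h₂.dist_le
    have k₁ := max_sub_le_add_abs h A.pos B.pos
    have k₂ := max_sub_le_add_abs h C.pos B.pos
    rw [abs_sub_comm] at k₂
    have := le_max_right (h - B.pos) 0
    rcases h₁.transport h hh with t₁ | t₁ <;> rcases h₂.transport h hh with t₂ | t₂
    · left; linarith
    · right; linarith
    · right; linarith
    · right; linarith

/-- If the excess changes, the segment from x to y meets the region beyond h, so its length splits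
at h. -/
lemma abs_excess_add {h x y : ℝ} (hne : max (y - h) 0 ≠ max (x - h) 0) :
    |max (y - h) 0 - max (x - h) 0| + max (h - x) 0 + max (h - y) 0 = |y - x| := by
  rcases le_total x h with hx | hx <;> rcases le_total y h with hy | hy
  · simp [hx, hy] at hne
  · rw [max_eq_left (sub_nonneg.2 hy), max_eq_right (sub_nonpos.2 hx),
      max_eq_left (sub_nonneg.2 hx), max_eq_right (sub_nonpos.2 hy),
      abs_of_nonneg (by linarith), abs_of_nonneg (by linarith)]
    ring
  · rw [max_eq_right (sub_nonpos.2 hy), max_eq_left (sub_nonneg.2 hx),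
      max_eq_right (sub_nonpos.2 hx), max_eq_left (sub_nonneg.2 hy),
      abs_of_nonpos (by linarith), abs_of_nonpos (by linarith)]
    ring
  · rw [max_eq_left (sub_nonneg.2 hy), max_eq_left (sub_nonneg.2 hx),
      max_eq_right (sub_nonpos.2 hx), max_eq_right (sub_nonpos.2 hy)]
    simp

lemma Leg.walkTo {A : State} (hA : A.Valid) {y : ℝ} (hy : (walkTo y).Allowed A) :
    Leg A ((walkTo y).result A) ((walkTo y).time A) where
  valid := ⟨sub_nonneg.2 hy, by
    have := hA.load_le
    have := abs_nonneg (y - A.pos)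
    simp only [Move.result]
    linarith⟩
  ration_eq := rfl
  dist_le := le_rfl
  mem_depots y hy := Or.inl hy
  transport h hh := by
    simp only [boxExcess, Move.result, Move.time]
    simp only [Move.Allowed] at hy
    by_cases hne : max (y - h) 0 = max (A.pos - h) 0
    · left; rw [hne]; simp
    · right
      have hs := abs_excess_add hne
      have hyx : y ≠ A.pos := by rintro rfl; exact hne rfl
      have hpos : 0 < |y - A.pos| := abs_pos.2 (sub_ne_zero.2 hyx)
      -- A walk of positive length needs a nonempty unsealed box, which leaves room for only one
      -- sealed box.
      have hc : A.carried < 2 := by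
        have : (A.carried : ℝ) < 2 := by linarith [hA.load_le]
        exact_mod_cast this
      have l₁ := le_abs_self (max (y - h) 0 - max (A.pos - h) 0)
      have l₂ := neg_abs_le (max (y - h) 0 - max (A.pos - h) 0)
      interval_cases A.carried
      · push_cast; linarith
      · push_cast; linarith

lemma Leg.take {A : State} (hA : A.Valid) (ht : Move.take.Allowed A) :
    Leg A (Move.take.result A) 0 where
  valid := ⟨hA.ration_nonneg, by
    have := ht.2
    simp only [Move.result]
    push_cast
    linarith⟩
  ration_eq := by simp [Move.result]
  dist_le := by simp [Move.result]
  mem_depots y hy := by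
    left
    simp only [Move.result] at hy
    split_ifs at hy
    · exact hy
    · exact Multiset.mem_of_mem_erase hy
  transport h hh := by
    left
    simp only [boxExcess, Move.result]
    push_cast
    split_ifs with h0
    -- The base supplies boxes for free: at position 0 the excess over h ≥ 0 vanishes.
    · rw [h0, max_eq_right (by linarith : (0 : ℝ) - h ≤ 0)]
      simp
    · have := excess_add_erase (ht.1.resolve_left h0) h
      linarith

lemma Leg.dump {A : State} (hA : A.Valid) (ht : Move.dump.Allowed A) :
    Leg A (Move.dump.result A) 0 where
  valid := ⟨hA.ration_nonneg, by
    have := hA.load_le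
    simp only [Move.result]
    rw [Nat.cast_sub ht]
    push_cast
    linarith⟩
  ration_eq := by simp [Move.result]
  dist_le := by simp [Move.result]
  mem_depots y hy := by
    simp only [Move.result, Multiset.mem_cons] at hy
    rcases hy with rfl | hy
    · right; simp [Move.result]
    · exact Or.inl hy
  transport h hh := by
    left
    simp only [boxExcess, Move.result]
    rw [Nat.cast_sub ht, Multiset.map_cons, Multiset.sum_cons]
    push_cast
    linarith

/-! ### Bookkeeping over the trips. -/

/-- The gain of a box that is unsealed at `p`, measured by walking beyond `1 / 2`. -/
noncomputable def gain (p : ℝ) : ℝ := min (max p 0) (1 - max p 0)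

/-- The situation at the beginning of a trip, that is, just after a box has been unsealed at time
`t`.  Here `S` is the sum of all (positive) positions where boxes have been unsealed so far, and
`M` is the sum of the gains of these boxes. -/
structure TripStart (γ : ℝ) (A : State) (t S M : ℝ) : Prop where
  valid : A.Valid
  ration_le : A.ration ≤ 1
  time_ge : 2 * (S + boxExcess 0 A) - max A.pos 0 ≤ t
  excess_le : 2 * boxExcess (1 / 2) A ≤ 2 * M - gain A.pos
  gain_le : M - gain A.pos ≤ S - max A.pos 0
  sum_ge : max A.pos 0 ≤ S
  pos_le : 2 * A.pos - 1 ≤ S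
  depots_le : ∀ y ∈ A.depots, 2 * y - 1 ≤ S
  reached : γ ∈ A.depots → 4 * γ - 4 ≤ S - M ∧ (30 * γ - 25) / 7 ≤ S

lemma tripStart_start (γ : ℝ) : TripStart γ start 0 0 0 where
  valid := ⟨le_rfl, by simp [start]⟩
  ration_le := by simp [start]
  time_ge := by simp [boxExcess, start]
  excess_le := by simp [boxExcess, start, gain]
  gain_le := by simp [start, gain]
  sum_ge := by simp [start]
  pos_le := by simp [start]
  depots_le := by simp [start]
  reached := by simp [start]

lemma gain_le_max (p : ℝ) : gain p ≤ max p 0 := min_le_left _ _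

lemma gain_le_one_sub (p : ℝ) : gain p ≤ 1 - max p 0 := min_le_right _ _

/-- Equality holds for p ≥ 0; `gain` is designed so that half a ration is accounted for at each end
of a trip. -/
lemma gain_add_excess_add (p : ℝ) :
    1 / 2 ≤ gain p + max (p - 1 / 2) 0 + max (1 / 2 - p) 0 := by
  unfold gain
  rcases le_total p 0 with h | h
  · rw [max_eq_right h, max_eq_left (by linarith : (0 : ℝ) ≤ 1 / 2 - p),
      max_eq_right (by linarith : p - 1 / 2 ≤ 0)]
    norm_num; linarith
  · rw [max_eq_left h]
    rcases le_total p (1 / 2) with h' | h'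
    · rw [min_eq_left (by linarith), max_eq_left (by linarith : (0 : ℝ) ≤ 1 / 2 - p)]
      linarith [le_max_right (p - 1 / 2) 0]
    · rw [min_eq_right (by linarith), max_eq_left (by linarith : (0 : ℝ) ≤ p - 1 / 2)]
      linarith [le_max_right (1 / 2 - p) 0]

lemma gain_add_excess_nonneg (p : ℝ) : 0 ≤ gain p + max (p - 1 / 2) 0 := by
  unfold gain
  rcases le_total p 0 with h | h
  · rw [max_eq_right h]; norm_num
  · rw [max_eq_left h]
    rcases le_total p (1 / 2) with h' | h'
    · rw [min_eq_left (by linarith)]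
      linarith [le_max_right (p - 1 / 2) 0]
    · rw [min_eq_right (by linarith), max_eq_left (by linarith : (0 : ℝ) ≤ p - 1 / 2)]
      linarith

/-- The bounds at the end of a trip, before the next box is unsealed. -/
structure TripEnd (γ : ℝ) (B : State) (t S M : ℝ) : Prop where
  valid : B.Valid
  time_ge : 2 * (S + boxExcess 0 B) - max B.pos 0 ≤ t
  excess_le : 2 * boxExcess (1 / 2) B ≤ 2 * M + gain B.pos + 2 * max (B.pos - 1 / 2) 0
  gain_le : M ≤ S
  sum_nonneg : 0 ≤ S
  pos_le : 2 * B.pos - 1 ≤ S + max B.pos 0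
  depots_le : ∀ y ∈ B.depots, 2 * y - 1 ≤ S + max B.pos 0
  -- Either a box is at hand to begin a new trip, or the walk may end at the base.
  reached : (1 ≤ B.carried ∨ B.pos = 0) → γ ∈ B.depots →
    4 * γ - 4 ≤ S + max B.pos 0 - (M + gain B.pos) ∧ (30 * γ - 25) / 7 ≤ S + max B.pos 0

lemma TripStart.excess_le_of_leg {γ : ℝ} {A B : State} {t S M d : ℝ}
    (hA : TripStart γ A t S M) (hL : Leg A B d) :
    2 * boxExcess (1 / 2) B ≤ 2 * M + gain B.pos + 2 * max (B.pos - 1 / 2) 0 := by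
  have hd : d ≤ 1 := by
    have := hL.valid.ration_nonneg
    have := hL.ration_eq
    linarith [hA.ration_le]
  have := hA.excess_le
  have := gain_add_excess_add A.pos
  have := gain_add_excess_add B.pos
  have := gain_add_excess_nonneg A.pos
  have := gain_add_excess_nonneg B.pos
  rcases hL.transport (1 / 2) (by norm_num) with h | h <;> linarith

lemma boxExcess_ge_of_mem {h y : ℝ} {s : State} (hy : y ∈ s.depots) :
    s.carried * max (s.pos - h) 0 + max (y - h) 0 ≤ boxExcess h s :=
  add_le_add le_rfl (excess_le_sum hy h)

/-- If a box is brought to `γ` in a trip from `A` to `B` and the next box is unsealed at a point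
that had not been reached before the trip, then part of the trip is walked three times. -/
lemma TripStart.three_crossings {γ : ℝ} {A B : State} {t S M d : ℝ}
    (hA : TripStart γ A t S M) (hL : Leg A B d) (hB : 1 ≤ B.carried) (hγ : γ ∈ B.depots)
    (hpos : (1 + S) / 2 < B.pos) :
    2 * γ - 1 + 2 * B.pos ≤ A.pos + B.pos + (1 + S) := by
  have hd : d ≤ 1 := by
    have := hL.valid.ration_nonneg
    have := hL.ration_eq
    linarith [hA.ration_le]
  have hS : 0 ≤ S := (le_max_right _ _).trans hA.sum_ge
  have hAY : A.pos ≤ (1 + S) / 2 := by linarith [hA.pos_le]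
  -- By `pos_le` and `depots_le`, no box lies beyond (1 + S) / 2 before this trip.
  have h0 : boxExcess ((1 + S) / 2) A = 0 := by
    unfold boxExcess
    rw [sum_excess_eq_zero fun y hy => by linarith [hA.depots_le y hy],
      max_eq_right (by linarith)]
    simp
  have h1 := boxExcess_ge_of_mem (h := (1 + S) / 2) hγ
  have hc : (1 : ℝ) ≤ B.carried := by exact_mod_cast hB
  have h2 : max (B.pos - (1 + S) / 2) 0 = B.pos - (1 + S) / 2 := max_eq_left (by linarith)
  have h3 : B.pos - (1 + S) / 2 ≤ B.carried * (B.pos - (1 + S) / 2) :=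
    le_mul_of_one_le_left (by linarith) hc
  have h4 := le_max_left (γ - (1 + S) / 2) 0
  have h5 := le_max_right (γ - (1 + S) / 2) 0
  have h6 : max (A.pos - (1 + S) / 2) 0 = 0 := max_eq_right (by linarith)
  have h7 := le_max_left ((1 + S) / 2 - A.pos) 0
  have h8 := le_max_right ((1 + S) / 2 - B.pos) 0
  rw [h2] at h1
  rcases hL.transport ((1 + S) / 2) (by linarith) with h | h
  · rw [h0, h2, h6] at h; linarith
  · rw [h0, h2, h6] at h; linarith

lemma TripStart.tripEnd {γ : ℝ} {A B : State} {t S M d : ℝ}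
    (hA : TripStart γ A t S M) (hL : Leg A B d) : TripEnd γ B (t + d) S M := by
  have hd : d ≤ 1 := by
    have := hL.valid.ration_nonneg
    have := hL.ration_eq
    linarith [hA.ration_le]
  have hdist := hL.dist_le
  have hd0 : 0 ≤ d := (abs_nonneg _).trans hdist
  have hS : 0 ≤ S := (le_max_right _ _).trans hA.sum_ge
  have hAS : A.pos ≤ S := (le_max_left _ _).trans hA.sum_ge
  have hgA := gain_le_max A.pos
  have hgA' := gain_le_one_sub A.pos
  have hgB := gain_le_max B.pos
  have hgB' := gain_le_one_sub B.pos
  have hA0 := le_max_left A.pos 0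
  have hA1 := le_max_right A.pos 0
  have hB0 := le_max_left B.pos 0
  have hB1 := le_max_right B.pos 0
  have hMS : M ≤ S := by linarith [hA.gain_le]
  refine ⟨hL.valid, ?_, hA.excess_le_of_leg hL, hMS, hS, ?_, ?_, ?_⟩
  · have := hA.time_ge
    have h1 := le_max_right (0 - A.pos) 0
    have h2 := le_max_right (0 - B.pos) 0
    rcases hL.transport 0 le_rfl with h | h <;> simp only [sub_zero] at h <;> linarith
  · have := (le_abs_self _).trans hdist
    linarith
  · intro y hy
    rcases hL.mem_depots y hy with h | h
    · linarith [hA.depots_le y h]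
    · linarith [le_abs_self (y - A.pos), le_abs_self (y - B.pos)]
  · intro hc hγ
    by_cases hγA : γ ∈ A.depots
    · have := hA.reached hγA
      constructor <;> linarith
    have hvisit := (hL.mem_depots γ hγ).resolve_left hγA
    have hse : 2 * γ - 1 ≤ A.pos + B.pos := by
      linarith [le_abs_self (γ - A.pos), le_abs_self (γ - B.pos)]
    -- Position minus gain is at least 2p - 1 at each end p of the trip; add this for A and B and
    -- use `hse`.
    refine ⟨by linarith [hA.gain_le], ?_⟩
    -- Here 30γ - 25 ≤ 0.
    by_cases hsmall : γ ≤ 5 / 6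
    · linarith
    push Not at hsmall
    have hfood : 2 * γ - 1 ≤ 2 * M + gain B.pos := by
      have h1 := hA.excess_le_of_leg hL
      have h2 := boxExcess_ge_of_mem (h := 1 / 2) hγ
      have h3 := le_max_left (γ - 1 / 2) 0
      -- The box carried at B pays for the last term of `excess_le_of_leg`; at the base that term is
      -- zero.
      have h4 : max (B.pos - 1 / 2) 0 ≤ B.carried * max (B.pos - 1 / 2) 0 := by
        rcases hc with hc | hc
        · exact le_mul_of_one_le_left (le_max_right _ _) (by exact_mod_cast hc)
        · rw [hc]; norm_num
      linarith
    have hgain := hA.gain_le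
    -- `hgain` and `hfood` give S + B ≥ γ - 2 + 2A + 3B/2. If B ≤ A, `hse` suffices. If A < B ≤ (1 +
    -- S)/2, `hse` turns it into S + B ≥ 5γ - 4 - B/2; six times this plus S + B ≥ 3B - 1 is the
    -- claim. Beyond (1 + S)/2, `three_crossings` replaces `hse`.
    rcases le_or_gt B.pos A.pos with hle | hlt
    · linarith
    · have hBcar : 1 ≤ B.carried := by
        rcases hc with hc | hc
        · exact hc
        · linarith
      rcases le_or_gt B.pos ((1 + S) / 2) with hY | hY
      · linarith
      · have := hA.three_crossings hL hBcar hγ hY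
        linarith

/-! ### From trips to whole walks, and the lower bounds. -/

lemma TripEnd.openBox {γ : ℝ} {B : State} {t S M : ℝ} (hB : TripEnd γ B t S M)
    (hc : 1 ≤ B.carried) :
    TripStart γ (Move.openBox.result B) t (S + max B.pos 0) (M + gain B.pos) := by
  have hex (h : ℝ) : boxExcess h (Move.openBox.result B) =
      boxExcess h B - max (B.pos - h) 0 := by
    simp only [boxExcess, Move.result]
    rw [Nat.cast_sub hc]
    push_cast
    ring
  refine ⟨⟨zero_le_one, ?_⟩, le_rfl, ?_, ?_, ?_, ?_, hB.pos_le, hB.depots_le,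
    hB.reached (Or.inl hc)⟩
  · have := hB.valid.load_le
    have := hB.valid.ration_nonneg
    simp only [Move.result]
    rw [Nat.cast_sub hc]
    push_cast
    linarith
  · have := hB.time_ge
    rw [hex]
    simp only [Move.result, sub_zero]
    linarith
  · have := hB.excess_le
    rw [hex]
    simp only [Move.result]
    linarith
  · have := hB.gain_le
    simp only [Move.result]
    linarith
  · have := hB.sum_nonneg
    simp only [Move.result]
    linarith

lemma exists_tripEnd {γ : ℝ} (w : List Move) : ∀ {A s : State} {t S M d : ℝ},
    TripStart γ A t S M → Leg A s d → Feasible s w →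
      ∃ S' M', TripEnd γ (finalState s w) (t + d + timeFrom s w) S' M' := by
  induction w with
  | nil =>
    intro A s t S M d hA hL _
    exact ⟨S, M, by simpa [finalState, timeFrom] using hA.tripEnd hL⟩
  | cons a w ih =>
    intro A s t S M d hA hL hw
    obtain ⟨ha, hw⟩ := hw
    simp only [finalState, timeFrom]
    cases a with
    | walkTo y =>
      have := ih hA (hL.trans (Leg.walkTo hL.valid ha)) hw
      simpa only [add_assoc] using this
    | take =>
      have := ih hA (hL.trans (Leg.take hL.valid ha)) hw
      simpa only [add_assoc, Move.time] using this
    | dump =>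
      have := ih hA (hL.trans (Leg.dump hL.valid ha)) hw
      simpa only [add_assoc, Move.time] using this
    | openBox =>
      have hT := (hA.tripEnd hL).openBox ha
      have := ih hT (Leg.refl hT.valid) hw
      simpa only [add_assoc, Move.time, add_zero, zero_add] using this

theorem IsPartA.lower_bounds {γ : ℝ} {w : List Move} (hw : IsPartA γ w) :
    (12 + 4 / 7) * γ - (9 + 1 / 7) ≤ duration w ∧ 14 * γ - 11 ≤ duration w := by
  obtain ⟨hf, hpos, hγ, hγ1⟩ := hw
  obtain ⟨S, M, hE⟩ := exists_tripEnd (γ := γ) w (tripStart_start γ)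
    (Leg.refl (tripStart_start γ).valid) hf
  have hr := hE.reached (Or.inr hpos) hγ
  have ht := hE.time_ge
  have hx := hE.excess_le
  have hb := boxExcess_ge_of_mem (h := 1 / 2) hγ
  have hm := le_max_left (γ - 1 / 2) 0
  simp only [hpos, gain, zero_add] at hr ht hx hb
  norm_num at hr ht hx hb
  have hS : 5 * γ - 9 / 2 ≤ S := by linarith
  change _ ≤ timeFrom start w ∧ _ ≤ timeFrom start w
  -- For γ ≤ 1 the missing second box would contribute γ - 1 ≤ 0, so the same estimate suffices.
  rcases le_or_gt γ 1 with h1 | h1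
  · have hb0 := boxExcess_ge_of_mem (h := 0) hγ
    have := le_max_left (γ - 0) 0
    rw [hpos] at hb0
    norm_num at hb0
    constructor <;> linarith
  · have hmem : γ - 1 ∈ (finalState start w).depots.erase γ :=
      (Multiset.mem_erase_of_ne (by linarith)).2 (hγ1 h1)
    have h2 := excess_add_erase hγ 0
    have h3 := excess_le_sum hmem 0
    have h4 := le_max_left (γ - 0) 0
    have h5 := le_max_left (γ - 1 - 0) 0
    have h6 : boxExcess 0 (finalState start w) =
        ((finalState start w).depots.map fun y => max (y - 0) 0).sum := by
      simp [boxExcess, hpos]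
    constructor <;> linarith

/-! ### The three walks, checked by computation. -/

lemma dudeneyPartA_isPartA : IsPartA (3 / 2) dudeneyPartA ∧ duration dudeneyPartA = 10 := by
  simp only [IsPartA, duration, dudeneyPartA, deliver, load, List.cons_append,
    List.nil_append, Feasible, finalState, timeFrom, Move.Allowed, Move.result, Move.time, start]
  norm_num [abs_of_nonneg, abs_of_neg, Multiset.erase_cons_tail]

lemma bestPartA_isPartA : IsPartA (23 / 16) bestPartA ∧ duration bestPartA = 9 + 1 / 8 := by
  simp only [IsPartA, duration, bestPartA, deliver, load, List.cons_append,
    List.nil_append, Feasible, finalState, timeFrom, Move.Allowed, Move.result, Move.time, start]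
  norm_num [abs_of_nonneg, abs_of_neg, Multiset.erase_cons_tail]

lemma dawnPartA_isPartA : IsPartA (141 / 116) dawnPartA ∧ duration dawnPartA = 6 + 4 / 29 := by
  simp only [IsPartA, duration, dawnPartA, deliver, load, List.cons_append,
    List.nil_append, Feasible, finalState, timeFrom, Move.Allowed, Move.result, Move.time, start]
  norm_num [abs_of_nonneg, abs_of_neg, Multiset.erase_cons_tail]

end Walkingholme

theorem mainTheorem3 :
    (∀ (γ : ℝ) (w : List Walkingholme.Move), Walkingholme.IsPartA γ w →
      (12 + 4 / 7) * γ - (9 + 1 / 7) ≤ Walkingholme.duration w ∧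
      14 * γ - 11 ≤ Walkingholme.duration w) ∧
    (Walkingholme.IsOptimalPartA (3 / 2) Walkingholme.dudeneyPartA ∧
      Walkingholme.duration Walkingholme.dudeneyPartA = 10) ∧
    (Walkingholme.IsOptimalPartA (23 / 16) Walkingholme.bestPartA ∧
      Walkingholme.duration Walkingholme.bestPartA = 9 + 1 / 8) ∧
    (Walkingholme.IsOptimalPartA (141 / 116) Walkingholme.dawnPartA ∧
      Walkingholme.duration Walkingholme.dawnPartA = 6 + 4 / 29) := by
  obtain ⟨h₁, t₁⟩ := Walkingholme.dudeneyPartA_isPartA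
  obtain ⟨h₂, t₂⟩ := Walkingholme.bestPartA_isPartA
  obtain ⟨h₃, t₃⟩ := Walkingholme.dawnPartA_isPartA
  refine ⟨fun γ w hw => hw.lower_bounds, ⟨⟨h₁, fun w hw => ?_⟩, t₁⟩, ⟨⟨h₂, fun w hw => ?_⟩, t₂⟩,
    ⟨h₃, fun w hw => ?_⟩, t₃⟩
  · linarith [hw.lower_bounds.2]
  · linarith [hw.lower_bounds.2]
  · linarith [hw.lower_bounds.1]
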